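/- Let $\alpha,\beta>0$ and let $Z_{\alpha,\beta}=(X,Y)$ be the piecewise linear vector field on $\mathbb R^3$ with switching plane $\Sigma=\{z=0\}$, given by $$X(x,y,z)=\Bigl(-\alpha,\;x-\beta,\;y-\tfrac{3\beta^2}{8\alpha}\Bigr)\ \text{ for } z>0,\qquad Y(x,y,z)=\Bigl(\alpha,\;\tfrac{3\alpha}{\beta}y+\beta,\;\tfrac{3\beta^2}{8\alpha}\Bigr)\ \text{ for } z<0 .$$ With $h(x,y,z)=z$ and $Wf=\langle\nabla f,W\rangle$, let $\Sigma^s=\{\xi\in\Sigma: Xh(\xi)<0<Yh(\xi)\}$ be the sliding region, $\partial\Sigma^s$ its boundary in $\Sigma$, and let $$\widetilde Z=\frac{Yh\cdot X-Xh\cdot Y}{Yh-Xh}$$ be the sliding vector field. Let $p=(0,0,0)$ and $q=\bigl(\tfrac{3\beta}{2},\tfrac{3\beta^2}{8\alpha},0\bigr)$. (a) The point $p$ is a hyperbolic pseudo saddle-focus of $Z_{\alpha,\beta}$. More precisely, $p\in\Sigma^s$, and $p$ is an unstable hyperbolic focus of $\widetilde Z$ as a vector field on $\Sigma$: $\widetilde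 Z(p)=0$, and the eigenvalues of the linearization of $\widetilde Z$ at $p$ along $\Sigma$ are $\dfrac{\alpha\pm i\sqrt{95}\,\alpha}{12\beta}$. (b) The point $q$ is a visible fold-regular point: $q\in\partial\Sigma^s$, $Xh(q)=0$, $X(Xh)(q)>0$ and $Yh(q)\neq0$. There is a sliding Shilnikov orbit $\Gamma_{\alpha,\beta}$ that connects $p$ to itself and passes through $q$. That is, the backward orbit of $q$ under $\widetilde Z$ is defined for all times $t\le 0$, lies in $\Sigma^s$ for $t<0$ and tends to $p$ as $t\to-\infty$; the orbit of $X$ that starts at $q$ lies in $z>0$ for $0<t<t_0$ and reaches $p$ at time $t_0=\dfrac{3\beta}{2\alpha}$; and $\Gamma_{\alpha,\beta}$ is the union of $\{p\}$ and these two arcs. -/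

import Mathlib

open Set Filter Topology

/-- The phase space `ℝ³` with its Euclidean structure. -/
abbrev E3 : Type := EuclideanSpace ℝ (Fin 3)

/-- The derivative `Wf(ξ) = ⟨∇f(ξ), W(ξ)⟩` of a function `f` in the direction of the
vector field `W`. -/
noncomputable def dirDeriv (W : E3 → E3) (f : E3 → ℝ) (ξ : E3) : ℝ :=
  fderiv ℝ f ξ (W ξ)

/-- A piecewise vector field `Z = (X, Y)` on `ℝ³`: it is `X` where `h > 0` and `Y` where
`h < 0`, and `0` is a regular value of the switching function `h`. -/
structure PiecewiseVectorField where
  /-- the vector field on `h > 0` -/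
  X : E3 → E3
  /-- the vector field on `h < 0` -/
  Y : E3 → E3
  /-- the switching function -/
  h : E3 → ℝ
  locallyLipschitz_X : LocallyLipschitz X
  locallyLipschitz_Y : LocallyLipschitz Y
  contDiff_h : ContDiff ℝ 1 h
  regular : ∀ ξ, h ξ = 0 → fderiv ℝ h ξ ≠ 0

namespace PiecewiseVectorField

variable (Z : PiecewiseVectorField)

/-- The function `Xh`. -/
noncomputable def Xh : E3 → ℝ := dirDeriv Z.X Z.h

/-- The function `Yh`. -/
noncomputable def Yh : E3 → ℝ := dirDeriv Z.Y Z.h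

/-- The switching surface `Σ = h⁻¹(0)`. -/
def switchingSurface : Set E3 := {ξ | Z.h ξ = 0}

/-- The sliding region `Σˢ`: both fields point towards `Σ`. -/
def slidingRegion : Set E3 := {ξ | Z.h ξ = 0 ∧ Z.Xh ξ < 0 ∧ 0 < Z.Yh ξ}

/-- The escaping region `Σᵉ`: both fields point away from `Σ`. -/
def escapingRegion : Set E3 := {ξ | Z.h ξ = 0 ∧ 0 < Z.Xh ξ ∧ Z.Yh ξ < 0}

/-- The boundary, relative to `Σ`, of a subset `S` of `Σ`. -/
def relBoundary (S : Set E3) : Set E3 :=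
  Z.switchingSurface ∩ closure S ∩ closure (Z.switchingSurface \ S)

/-- The sliding vector field `(Yh • X - Xh • Y) / (Yh - Xh)`. The formula makes sense at every
point of `ℝ³` where `Yh ≠ Xh`, in particular near every point of `Σˢ` and `Σᵉ`. -/
noncomputable def slidingField (ξ : E3) : E3 :=
  (Z.Yh ξ - Z.Xh ξ)⁻¹ • (Z.Yh ξ • Z.X ξ - Z.Xh ξ • Z.Y ξ)

/-- The tangent plane of `Σ` at a point `ξ` of `Σ`. -/
noncomputable def tangentPlane (ξ : E3) : Submodule ℝ E3 :=
  LinearMap.ker (fderiv ℝ Z.h ξ).toLinearMap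

/-- The linearization at `ξ` of the sliding vector field as a vector field on the surface `Σ`: the
derivative along `Σ`, as an endomorphism of the tangent plane. As the sliding vector field is
tangent to `Σ`, at its zeros its derivative maps the tangent plane into itself, and the
orthogonal projection does nothing except fix the codomain. -/
noncomputable def slidingLinearization (ξ : E3) :
    Z.tangentPlane ξ →ₗ[ℝ] Z.tangentPlane ξ :=
  (Z.tangentPlane ξ).orthogonalProjectionOnto.toLinearMap ∘ₗ
    (fderiv ℝ Z.slidingField ξ).toLinearMap ∘ₗ (Z.tangentPlane ξ).subtype

/-- The two complex eigenvalues, with multiplicity, of the linearized sliding vector field. -/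
noncomputable def slidingEigenvalues (ξ : E3) : Multiset ℂ :=
  (Z.slidingLinearization ξ).charpoly.aroots ℂ

/-- `p` is a pseudo-equilibrium: a zero of the sliding vector field in `Σˢ ∪ Σᵉ`. The sliding
vector field is required to be `C¹` at `p`, so that it has a linearization there. -/
def IsPseudoEquilibrium (p : E3) : Prop :=
  p ∈ Z.slidingRegion ∪ Z.escapingRegion ∧ ContDiffAt ℝ 1 Z.slidingField p ∧
    Z.slidingField p = 0

/-- `p` is an unstable hyperbolic focus of the sliding vector field: the eigenvalues are not real
and have positive real parts. -/
def IsUnstableHyperbolicFocus (p : E3) : Prop :=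
  Z.IsPseudoEquilibrium p ∧ ∀ l ∈ Z.slidingEigenvalues p, 0 < l.re ∧ l.im ≠ 0

/-- `p` is a stable hyperbolic focus of the sliding vector field: the eigenvalues are not real
and have negative real parts. -/
def IsStableHyperbolicFocus (p : E3) : Prop :=
  Z.IsPseudoEquilibrium p ∧ ∀ l ∈ Z.slidingEigenvalues p, l.re < 0 ∧ l.im ≠ 0

/-- A hyperbolic pseudo saddle-focus: an unstable hyperbolic focus of the sliding vector field
in `Σˢ`, or a stable one in `Σᵉ`. -/
def IsHyperbolicPseudoSaddleFocus (p : E3) : Prop :=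
  (p ∈ Z.slidingRegion ∧ Z.IsUnstableHyperbolicFocus p) ∨
    (p ∈ Z.escapingRegion ∧ Z.IsStableHyperbolicFocus p)

/-- `q` is a visible fold of `X`: `q ∈ Σ`, `Xh(q) = 0` and `X²h(q) > 0`. -/
def IsVisibleFoldX (q : E3) : Prop :=
  Z.h q = 0 ∧ Z.Xh q = 0 ∧ DifferentiableAt ℝ Z.Xh q ∧ 0 < dirDeriv Z.X Z.Xh q

/-- `q` is a visible fold-regular point: it lies on the boundary of `Σˢ` or of `Σᵉ`, it is a
visible fold of `X`, and `Y` is transverse to `Σ` at `q`. -/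
def IsVisibleFoldRegular (q : E3) : Prop :=
  q ∈ Z.relBoundary Z.slidingRegion ∪ Z.relBoundary Z.escapingRegion ∧
    Z.IsVisibleFoldX q ∧ Z.Yh q ≠ 0

/-- `Γ` is a sliding Shilnikov orbit through the visible fold-regular point `q`, connecting the
hyperbolic pseudo saddle-focus `p` to itself, and `t₀` is the time that the flow of `X` takes from
`q` to `p`. If `p ∈ Σˢ` and `q ∈ ∂Σˢ`, then `Γ` consists of `p`, of the backward orbit `γ` of `q`
under the sliding vector field, which lies in `Σˢ` and tends to `p`, and of the orbit `σ` of `X`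
from `q` to `p` through `h > 0` in time `t₀ > 0`. If `p ∈ Σᵉ` and `q ∈ ∂Σᵉ`, time is reversed. -/
def IsSlidingShilnikovOrbit (p q : E3) (t₀ : ℝ) (Γ : Set E3) : Prop :=
  Z.IsHyperbolicPseudoSaddleFocus p ∧ Z.IsVisibleFoldRegular q ∧
  ((p ∈ Z.slidingRegion ∧ q ∈ Z.relBoundary Z.slidingRegion ∧ 0 < t₀ ∧
      ∃ γ σ : ℝ → E3,
        (γ 0 = q ∧ IsIntegralCurveOn γ (fun _ => Z.slidingField) (Iic 0) ∧
          (∀ t < 0, γ t ∈ Z.slidingRegion) ∧ Tendsto γ atBot (𝓝 p)) ∧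
        (σ 0 = q ∧ IsIntegralCurveOn σ (fun _ => Z.X) (Icc 0 t₀) ∧
          (∀ t ∈ Ioo 0 t₀, 0 < Z.h (σ t)) ∧ σ t₀ = p) ∧
        Γ = {p} ∪ γ '' Iic 0 ∪ σ '' Icc 0 t₀) ∨
   (p ∈ Z.escapingRegion ∧ q ∈ Z.relBoundary Z.escapingRegion ∧ t₀ < 0 ∧
      ∃ γ σ : ℝ → E3,
        (γ 0 = q ∧ IsIntegralCurveOn γ (fun _ => Z.slidingField) (Ici 0) ∧
          (∀ t > 0, γ t ∈ Z.escapingRegion) ∧ Tendsto γ atTop (𝓝 p)) ∧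
        (σ 0 = q ∧ IsIntegralCurveOn σ (fun _ => Z.X) (Icc t₀ 0) ∧
          (∀ t ∈ Ioo t₀ 0, 0 < Z.h (σ t)) ∧ σ t₀ = p) ∧
        Γ = {p} ∪ γ '' Ici 0 ∪ σ '' Icc t₀ 0))

end PiecewiseVectorField

/-- The piecewise linear vector field `Z_{α,β}`, with switching function `h(x, y, z) = z`. -/
noncomputable def piecewiseLinear (α β : ℝ) : PiecewiseVectorField where
  X v := !₂[-α, v 0 - β, v 1 - 3 * β ^ 2 / (8 * α)]
  Y v := !₂[α, 3 * α / β * v 1 + β, 3 * β ^ 2 / (8 * α)]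
  h v := v 2
  locallyLipschitz_X := by
    refine ContDiff.locallyLipschitz (𝕂 := ℝ) (contDiff_euclidean.2 fun i => ?_)
    fin_cases i <;> simp <;> fun_prop
  locallyLipschitz_Y := by
    refine ContDiff.locallyLipschitz (𝕂 := ℝ) (contDiff_euclidean.2 fun i => ?_)
    fin_cases i <;> simp <;> fun_prop
  contDiff_h := by fun_prop
  regular ξ _ h0 := by
    have h1 : fderiv ℝ (fun v : E3 => v 2) ξ = EuclideanSpace.proj (2 : Fin 3) :=
      (EuclideanSpace.proj (𝕜 := ℝ) (2 : Fin 3)).fderiv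
    have h2 := congrArg (fun L : E3 →L[ℝ] ℝ => L !₂[0, 0, 1]) (h1.symm.trans h0)
    simp at h2

/-! The local claims are computations: at `p` the linearized sliding field has trace α/(6β) and
determinant 2α²/(3β²), and the orbit of `X` from `q` is polynomial, with z = t²(3β - 2αt)/12. The
substance is that the backward sliding orbit of `q` stays in Σˢ and tends to `p`. Put x = βu, y =
3β²v/(8α) and s = -8αt/(3β). The parameters disappear: `p` becomes the origin, a sink, `q` becomes
(3/2, 1), and Σˢ becomes v < 1. On the box -1/5 ≤ u ≤ 2, -2 ≤ v ≤ 1 the function `lyapunov` has its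
strict minimum -4/27 at the origin and decreases along orbits. Its sublevel set through `q` misses
every side of the box but v = 1, and there it forces u > 1, where the flow points inward. Hence the
orbit is trapped (`mem_openBox`), and comparing the function with its dissipation rate gives
exponential decay (`tendsto_zero`). Global existence comes from composing the field with the
projection onto the box. -/

/-- A bounded Lipschitz vector field on a Banach space is complete. -/
theorem exists_isIntegralCurve_of_lipschitzWith_of_bounded {E : Type*} [NormedAddCommGroup E]
    [NormedSpace ℝ E] [CompleteSpace E] {f : E → E} {K L : NNReal} (hf : LipschitzWith K f)
    (hL : ∀ x, ‖f x‖ ≤ L) (x₀ : E) :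
    ∃ γ : ℝ → E, γ 0 = x₀ ∧ IsIntegralCurve γ fun _ => f := by
  have local_sol : ∀ n : ℕ, ∃ γ : ℝ → E, γ 0 = x₀ ∧
      ∀ t ∈ Ioo (-(n + 1 : ℝ)) (n + 1), HasDerivAt γ (f (γ t)) t := by
    intro n
    have h0 : (0 : ℝ) ∈ Icc (-(n + 1 : ℝ)) (n + 1) := ⟨by linarith [n.cast_nonneg (α := ℝ)],
      by positivity⟩
    -- At speed at most `L`, a solution moves at most `L * (n + 1)` in this time, so no smallness of
    -- the interval is needed.
    have hP : IsPicardLindelof (fun _ => f) (⟨0, h0⟩ : Icc (-(n + 1 : ℝ)) (n + 1)) x₀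
        (L * (n + 1)) 0 L K :=
      { lipschitzOnWith := fun _ _ => hf.lipschitzOnWith
        continuousOn := fun _ _ => continuousOn_const
        norm_le := fun _ _ x _ => hL x
        mul_max_le := by simp }
    obtain ⟨γ, hγ0, hγ⟩ := hP.exists_eq_forall_mem_Icc_hasDerivWithinAt₀
    exact ⟨γ, hγ0, fun t ht => (hγ t (Ioo_subset_Icc_self ht)).hasDerivAt (Icc_mem_nhds ht.1 ht.2)⟩
  choose φ hφ0 hφ using local_sol
  have agree : ∀ m n : ℕ, m ≤ n → EqOn (φ m) (φ n) (Ioo (-(m + 1 : ℝ)) (m + 1)) := by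
    intro m n hmn
    have hmn' : (m : ℝ) ≤ n := by exact_mod_cast hmn
    refine ODE_solution_unique_of_mem_Ioo (v := fun _ => f) (s := fun _ => univ) (K := K) (t₀ := 0)
      (fun _ _ => hf.lipschitzOnWith) ⟨by linarith [m.cast_nonneg (α := ℝ)], by positivity⟩
      (fun t ht => ⟨hφ m t ht, mem_univ _⟩)
      (fun t ht => ⟨hφ n t ⟨by linarith [ht.1], by linarith [ht.2]⟩, mem_univ _⟩) ?_
    rw [hφ0, hφ0]
  -- The index ⌈|t|⌉ grows with |t|; near a given time all the pieces agree with the single solution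
  -- `φ N`.
  refine ⟨fun t => φ ⌈|t|⌉₊ t, hφ0 _, fun t => ?_⟩
  set N := ⌈|t|⌉₊ + 1
  have htN : |t| < N := by
    push_cast [N]
    linarith [Nat.le_ceil |t|]
  have eq_near : ∀ s : ℝ, |s| < N → φ ⌈|s|⌉₊ s = φ N s := fun s hs =>
    agree _ _ (Nat.ceil_le.2 hs.le)
      (abs_lt.1 ((Nat.le_ceil |s|).trans_lt (lt_add_one _)))
  have hev : ∀ᶠ s in 𝓝 t, φ ⌈|s|⌉₊ s = φ N s :=
    (continuous_abs.continuousAt.eventually (gt_mem_nhds htN)).mono eq_near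
  have hd := hφ N t (abs_lt.1 (htN.trans (lt_add_one _)))
  have := hd.congr_of_eventuallyEq hev
  rwa [← eq_near t htN] at this

/-! ### The dimensionless planar system and its Lyapunov function -/

namespace PlanarSliding

/-- The sliding vector field of `piecewiseLinear`, in reversed time and in dimensionless
coordinates. -/
noncomputable def field (w : ℝ × ℝ) : ℝ × ℝ :=
  (3 / 8 * w.2 / (2 - w.2), (9 / 8 * w.2 ^ 2 - w.1 - w.2 / 8) / (2 - w.2))

/-- The function `e^{6u}` times the Lyapunov function. -/
noncomputable def quad (w : ℝ × ℝ) : ℝ :=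
  w.2 ^ 2 + w.1 * w.2 / 9 - 8 / 9 * w.1 - 4 / 27

/-- A strict Lyapunov function for `field`. -/
noncomputable def lyapunov (w : ℝ × ℝ) : ℝ := Real.exp (-6 * w.1) * quad w

/-- The dissipation rate of `lyapunov`, up to a positive factor. -/
noncomputable def dissipation (w : ℝ × ℝ) : ℝ :=
  w.1 ^ 2 / 9 + w.1 * w.2 / 72 + (5 / 24 + w.1 / 8) * w.2 ^ 2

/-- A closed box in which the homoclinic orbit stays. -/
def box : Set (ℝ × ℝ) := Icc (-1 / 5) 2 ×ˢ Icc (-2) 1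

/-- The interior of `box`. -/
def openBox : Set (ℝ × ℝ) := Ioo (-1 / 5) 2 ×ˢ Ioo (-2) 1

theorem closure_openBox : closure openBox = box := by
  rw [openBox, box, closure_prod_eq, closure_Ioo (by norm_num), closure_Ioo (by norm_num)]

theorem isOpen_openBox : IsOpen openBox := isOpen_Ioo.prod isOpen_Ioo

theorem openBox_subset_box : openBox ⊆ box := closure_openBox ▸ subset_closure

/-- For u ≥ -1/5 the coefficient of v² is at least 11/60, which leaves a positive definite quadratic
form. -/
theorem sq_add_sq_le_dissipation {w : ℝ × ℝ} (hw : -1 / 5 ≤ w.1) :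
    (w.1 ^ 2 + w.2 ^ 2) / 10 ≤ dissipation w := by
  unfold dissipation
  nlinarith [mul_nonneg (sub_nonneg.2 hw) (sq_nonneg w.2), sq_nonneg (w.1 + w.2), sq_nonneg w.1,
    sq_nonneg w.2]

/-- The sublevel set of the Lyapunov function meets only the side `v = 1` of `box`. -/
theorem mem_strip_of_lyapunov_le {w : ℝ × ℝ} (hw : w ∈ box)
    (h : lyapunov w ≤ lyapunov (3 / 2, 1)) : -1 / 5 < w.1 ∧ w.1 < 2 ∧ -2 < w.2 := by
  obtain ⟨⟨h1, h2⟩, h3, h4⟩ := hw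
  have hq : quad w ≤ -(17 / 54) * Real.exp (6 * w.1 - 9) := by
    have e : Real.exp (6 * w.1 - 9) = Real.exp (6 * w.1) * Real.exp (-6 * (3 / 2)) := by
      rw [← Real.exp_add]; ring_nf
    have e' : Real.exp (6 * w.1) * Real.exp (-6 * w.1) = 1 := by
      rw [← Real.exp_add]; simp
    have := mul_le_mul_of_nonneg_left h (Real.exp_pos (6 * w.1)).le
    simp only [lyapunov] at this
    -- Multiplying by e^{6u} isolates `quad w`; the value of `quad` at (3/2, 1) is -17/54.
    rw [← mul_assoc, e', one_mul, ← mul_assoc, ← e] at this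
    refine this.trans_eq ?_
    norm_num [quad]
    ring
  have hpos := Real.exp_pos (6 * w.1 - 9)
  unfold quad at hq
  refine ⟨lt_of_le_of_ne h1 fun h5 => ?_, lt_of_le_of_ne h2 fun h5 => ?_,
    lt_of_le_of_ne h3 fun h5 => ?_⟩
  -- On u = -1/5, `quad` is v² - v/45 + 4/135 > 0.
  · rw [← h5] at hq hpos
    nlinarith [sq_nonneg (w.2 - 1 / 90)]
  -- On u = 2, `quad` is at least -1/81 - 52/27, while e³ ≥ 17/2 puts the bound below -2.6.
  · have := Real.quadratic_le_exp_of_nonneg (x := 6 * w.1 - 9) (by rw [h5]; norm_num)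
    rw [h5] at hq this
    nlinarith [sq_nonneg (w.2 + 1 / 9)]
  · rw [← h5] at hq
    nlinarith

/-- On v = 1, `quad` is 23/27 - 7u/9, which is negative only for u > 23/21. -/
theorem one_lt_of_lyapunov_le {w : ℝ × ℝ} (h2 : w.2 = 1)
    (h : lyapunov w ≤ lyapunov (3 / 2, 1)) : 1 < w.1 := by
  have h0 : lyapunov w < 0 := h.trans_lt (mul_neg_of_pos_of_neg (Real.exp_pos _)
    (by norm_num [quad]))
  have hq : quad w < 0 := by
    by_contra hn
    exact absurd (mul_nonneg (Real.exp_pos (-6 * w.1)).le (not_lt.1 hn)) (not_le.2 h0)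
  unfold quad at hq
  rw [h2] at hq
  linarith

theorem field_snd_neg {w : ℝ × ℝ} (h2 : w.2 = 1) (h1 : 1 < w.1) : (field w).2 < 0 := by
  simp only [field, h2]
  norm_num
  linarith

/-- The coefficients are tuned to this identity: the exponent -6 removes v³, the constant 4/27
removes the linear term in v, and 8/9 cancels the bulk of the uv term. The cross term uv/9 supplies
the u² in `dissipation`. -/
theorem hasDerivAt_lyapunov {w : ℝ → ℝ × ℝ} {s : ℝ} (h2 : (w s).2 ≠ 2)
    (hw : HasDerivAt w (field (w s)) s) :
    HasDerivAt (fun r => lyapunov (w r))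
      (-(Real.exp (-6 * (w s).1) * (dissipation (w s) / (2 - (w s).2)))) s := by
  have hu : HasDerivAt (fun r => (w r).1) (field (w s)).1 s := hw.fst
  have hv : HasDerivAt (fun r => (w r).2) (field (w s)).2 s := hw.snd
  have hd : 2 - (w s).2 ≠ 0 := sub_ne_zero.2 h2.symm
  have := (hu.const_mul (-6)).exp.mul
    ((((hv.pow 2).add ((hu.mul hv).div_const 9)).sub (hu.const_mul (8 / 9))).sub_const (4 / 27))
  refine this.congr_deriv ?_
  simp only [field, dissipation, Pi.mul_apply, Pi.add_apply, Pi.pow_apply, Pi.sub_apply]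
  field_simp
  ring

theorem lyapunov_antitoneOn {w : ℝ → ℝ × ℝ} {D : Set ℝ} (hD : Convex ℝ D)
    (hw : ∀ s ∈ D, HasDerivAt w (field (w s)) s) (hbox : ∀ s ∈ D, w s ∈ box) :
    AntitoneOn (fun s => lyapunov (w s)) D := by
  have hne : ∀ s ∈ D, (w s).2 < 2 := fun s hs => (hbox s hs).2.2.trans_lt (by norm_num)
  have hder := fun s (hs : s ∈ D) => hasDerivAt_lyapunov (hne s hs).ne (hw s hs)
  refine antitoneOn_of_hasDerivWithinAt_nonpos hD
    (fun s hs => (hder s hs).continuousAt.continuousWithinAt)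
    (fun s hs => (hder s (interior_subset hs)).hasDerivWithinAt) fun s hs => ?_
  have hs := interior_subset hs
  refine neg_nonpos.2 (mul_nonneg (Real.exp_pos _).le (div_nonneg ?_ (sub_pos.2 (hne s hs)).le))
  exact le_trans (by positivity) (sq_add_sq_le_dissipation (hbox s hs).1.1)

/-! ### Confinement to the box -/

/-- A solution that satisfies the equation while it is in the box never leaves the box. -/
theorem mem_openBox {w : ℝ → ℝ × ℝ} (hcont : Continuous w) (h0 : w 0 = (3 / 2, 1))
    (hw : ∀ s, w s ∈ box → HasDerivAt w (field (w s)) s) {s : ℝ} (hs : 0 < s) :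
    w s ∈ openBox := by
  have hb0 : w 0 ∈ box := by
    rw [h0]; refine ⟨⟨?_, ?_⟩, ?_, ?_⟩ <;> norm_num
  -- On v = 1 with u > 1, v is strictly decreasing: it exceeds 1 just before `t` and is below 1 just
  -- after.
  have sign_near : ∀ t, w t ∈ box → (w t).2 = 1 → 1 < (w t).1 →
      ∀ᶠ r in 𝓝 t, SignType.sign ((w r).2 - 1) = SignType.sign (t - r) := by
    intro t ht h2 h1
    refine eventually_nhdsWithin_sign_eq_of_deriv_neg ?_ (by rw [h2, sub_self])
    have : HasDerivAt (fun r => (w r).2 - 1) (field (w t)).2 t := (hw t ht).snd.sub_const 1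
    rw [this.deriv]
    exact field_snd_neg h2 h1
  have hstart : ∀ᶠ r in 𝓝[>] (0 : ℝ), w r ∈ openBox := by
    have e1 := (sign_near 0 hb0 (by rw [h0]) (by rw [h0]; norm_num)).filter_mono
      (nhdsWithin_le_nhds (s := Ioi 0))
    have e2 : ∀ᶠ r in 𝓝[>] (0 : ℝ), w r ∈ Ioo (-1 / 5 : ℝ) 2 ×ˢ Ioi (-2 : ℝ) :=
      hcont.continuousAt.continuousWithinAt.eventually
        ((isOpen_Ioo.prod isOpen_Ioi).mem_nhds (by
          rw [h0]; refine ⟨⟨?_, ?_⟩, ?_⟩ <;> norm_num))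
    filter_upwards [e1, e2, self_mem_nhdsWithin] with r hr1 hr2 hr3
    rw [zero_sub, sign_neg (neg_lt_zero.2 hr3), sign_eq_neg_one_iff] at hr1
    exact ⟨hr2.1, hr2.2, sub_neg.1 hr1⟩
  by_contra hcon
  -- Consider the first positive time outside the open box. The sublevel estimate puts that point on
  -- v = 1 with u > 1, so v > 1 just before, a contradiction.
  set A : Set ℝ := {t | 0 < t ∧ w t ∉ openBox}
  have hA : A.Nonempty := ⟨s, hs, hcon⟩
  have hAb : BddBelow A := ⟨0, fun t ht => ht.1.le⟩
  set T := sInf A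
  have hTpos : 0 < T := by
    obtain ⟨ε, hε, hε'⟩ := mem_nhdsGT_iff_exists_Ioo_subset.1 hstart
    exact lt_of_lt_of_le hε (le_csInf hA fun t ht => not_lt.1 fun h => ht.2 (hε' ⟨ht.1, h⟩))
  have hTout : w T ∉ openBox := by
    have : closure A ⊆ w ⁻¹' openBoxᶜ :=
      closure_minimal (fun t ht => ht.2) (isOpen_openBox.isClosed_compl.preimage hcont)
    exact this (csInf_mem_closure hA hAb)
  have hin : ∀ t ∈ Ioo 0 T, w t ∈ openBox := fun t ht => by
    by_contra h
    exact notMem_of_lt_csInf ht.2 hAb ⟨ht.1, h⟩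
  have hbox : ∀ t ∈ Icc 0 T, w t ∈ box := by
    have : MapsTo w (closure (Ioo 0 T)) (closure openBox) := MapsTo.closure hin hcont
    rwa [closure_Ioo hTpos.ne, closure_openBox] at this
  have hT : T ∈ Icc 0 T := right_mem_Icc.2 hTpos.le
  have hle : lyapunov (w T) ≤ lyapunov (3 / 2, 1) := by
    rw [← h0]
    exact lyapunov_antitoneOn (convex_Icc 0 T) (fun t ht => hw t (hbox t ht)) hbox
      (left_mem_Icc.2 hTpos.le) hT hTpos.le
  obtain ⟨h1, h2, h3⟩ := mem_strip_of_lyapunov_le (hbox T hT) hle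
  have h4 : (w T).2 = 1 := by
    by_contra h
    exact hTout ⟨⟨h1, h2⟩, h3, lt_of_le_of_ne (hbox T hT).2.2 h⟩
  have e1 := (sign_near T (hbox T hT) h4 (one_lt_of_lyapunov_le h4 hle)).filter_mono
    (nhdsWithin_le_nhds (s := Iio T))
  obtain ⟨r, hr, hr'⟩ := (e1.and (Ioo_mem_nhdsLT hTpos)).exists
  rw [sign_pos (sub_pos.2 hr'.2), sign_eq_one_iff] at hr
  linarith [(hin r hr').2.2]

/-! ### Exponential convergence to the origin -/

theorem sq_add_sq_le_lyapunov {w : ℝ × ℝ} (hw : w ∈ box) :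
    Real.exp (-12) / 2 * (w.1 ^ 2 + w.2 ^ 2) ≤ lyapunov w + 4 / 27 := by
  obtain ⟨⟨h1, h2⟩, h3, h4⟩ := hw
  have e1 : Real.exp (-6 * w.1) * Real.exp (6 * w.1) = 1 := by
    rw [← Real.exp_add]; simp
  have e2 : Real.exp (-12) ≤ Real.exp (-6 * w.1) := Real.exp_le_exp.2 (by linarith)
  have e3 : (1 + 3 * w.1) ^ 2 ≤ Real.exp (6 * w.1) := by
    have := Real.add_one_le_exp (3 * w.1)
    calc (1 + 3 * w.1) ^ 2 ≤ Real.exp (3 * w.1) ^ 2 := by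
          apply pow_le_pow_left₀ <;> linarith
      _ = Real.exp (6 * w.1) := by rw [sq, ← Real.exp_add]; ring_nf
  -- Since 8/9 = 6 · 4/27, the bound `e3` absorbs both the constant and the linear term of `quad`,
  -- leaving v² + uv/9 + 4u²/3.
  have e4 : (w.1 ^ 2 + w.2 ^ 2) / 2 ≤ quad w + 4 / 27 * Real.exp (6 * w.1) := by
    unfold quad
    nlinarith [sq_nonneg (w.1 + w.2)]
  calc Real.exp (-12) / 2 * (w.1 ^ 2 + w.2 ^ 2)
      = Real.exp (-12) * ((w.1 ^ 2 + w.2 ^ 2) / 2) := by ring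
    _ ≤ Real.exp (-6 * w.1) * (quad w + 4 / 27 * Real.exp (6 * w.1)) := by gcongr
    _ = lyapunov w + 4 / 27 := by
      unfold lyapunov
      linear_combination 4 / 27 * e1

/-- On the box both sides are comparable to u² + v² up to positive factors; this is the differential
inequality behind exponential decay. -/
theorem lyapunov_le_dissipation : ∃ k > 0, ∀ w ∈ box,
    k * (lyapunov w + 4 / 27) ≤
      Real.exp (-6 * w.1) * (dissipation w / (2 - w.2)) := by
  refine ⟨(40 * (6 + 6 * Real.exp 12))⁻¹, by positivity, fun w hw => ?_⟩
  have hdis := sq_add_sq_le_dissipation hw.1.1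
  obtain ⟨⟨h1, h2⟩, h3, h4⟩ := hw
  have e1 : Real.exp (-6 * w.1) * Real.exp (6 * w.1) = 1 := by
    rw [← Real.exp_add]; simp
  have e2 : Real.exp (6 * w.1) ≤ Real.exp 12 := Real.exp_le_exp.2 (by linarith)
  -- `a2` bounds the left side by 6u(e^{6u} - 1). For u ≥ 0 apply `a2` again; for u ≤ 0 use e^{6u} -
  -- 1 ≥ 6u.
  have e3 : Real.exp (6 * w.1) - 1 - 6 * w.1 ≤ 36 * w.1 ^ 2 * (1 + Real.exp 12) := by
    have a1 := Real.add_one_le_exp (-6 * w.1)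
    have a2 : Real.exp (6 * w.1) - 1 ≤ 6 * w.1 * Real.exp (6 * w.1) := by
      nlinarith [Real.exp_pos (6 * w.1)]
    have a3 := Real.add_one_le_exp (6 * w.1)
    have a4 := Real.exp_pos (6 * w.1)
    rcases le_total 0 w.1 with hp | hp
    · nlinarith [mul_nonneg hp (sub_nonneg.2 a2), mul_nonneg (sq_nonneg w.1) (sub_nonneg.2 e2),
        sq_nonneg w.1]
    · nlinarith [mul_nonneg (neg_nonneg.2 hp) (sub_nonneg.2 a3), sq_nonneg w.1,
        mul_nonneg (sq_nonneg w.1) (Real.exp_pos 12).le]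
  have e4 : quad w + 4 / 27 * Real.exp (6 * w.1) ≤
      (6 + 6 * Real.exp 12) * (w.1 ^ 2 + w.2 ^ 2) := by
    unfold quad
    nlinarith [sq_nonneg (w.1 - w.2), sq_nonneg w.1, sq_nonneg w.2,
        mul_nonneg (sq_nonneg w.1) (Real.exp_pos 12).le,
        mul_nonneg (sq_nonneg w.2) (Real.exp_pos 12).le]
  -- On the box 2 - v ≤ 4, hence 40 = 10 · 4.
  have e5 : (w.1 ^ 2 + w.2 ^ 2) / 40 ≤ dissipation w / (2 - w.2) := by
    rw [le_div_iff₀ (by linarith)]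
    nlinarith [sq_nonneg w.1, sq_nonneg w.2]
  calc (40 * (6 + 6 * Real.exp 12))⁻¹ * (lyapunov w + 4 / 27)
      = (40 * (6 + 6 * Real.exp 12))⁻¹ *
          (Real.exp (-6 * w.1) * (quad w + 4 / 27 * Real.exp (6 * w.1))) := by
        unfold lyapunov
        linear_combination -(40 * (6 + 6 * Real.exp 12))⁻¹ * 4 / 27 * e1
    _ ≤ (40 * (6 + 6 * Real.exp 12))⁻¹ *
          (Real.exp (-6 * w.1) * ((6 + 6 * Real.exp 12) * (w.1 ^ 2 + w.2 ^ 2))) := by gcongr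
    _ = Real.exp (-6 * w.1) * ((w.1 ^ 2 + w.2 ^ 2) / 40) := by
        have : (6 + 6 * Real.exp 12) ≠ 0 := by positivity
        field_simp
    _ ≤ Real.exp (-6 * w.1) * (dissipation w / (2 - w.2)) := by gcongr

/-- Solutions that stay in the box tend to the origin. -/
theorem tendsto_zero {w : ℝ → ℝ × ℝ} (hbox : ∀ s, 0 ≤ s → w s ∈ box)
    (hw : ∀ s, 0 ≤ s → HasDerivAt w (field (w s)) s) : Tendsto w atTop (𝓝 0) := by
  obtain ⟨k, hk, hkW⟩ := lyapunov_le_dissipation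
  have hne : ∀ s, 0 ≤ s → (w s).2 ≠ 2 := fun s hs =>
    ((hbox s hs).2.2.trans_lt (by norm_num)).ne
  have hder : ∀ s, 0 ≤ s → HasDerivAt (fun r => (lyapunov (w r) + 4 / 27) * Real.exp (k * r))
      (-(Real.exp (-6 * (w s).1) * (dissipation (w s) / (2 - (w s).2))) * Real.exp (k * s) +
        (lyapunov (w s) + 4 / 27) * (Real.exp (k * s) * (k * 1))) s := fun s hs =>
    ((hasDerivAt_lyapunov (hne s hs) (hw s hs)).add_const (4 / 27)).mul
      ((hasDerivAt_id s).const_mul k).exp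
  have hanti : AntitoneOn (fun s => (lyapunov (w s) + 4 / 27) * Real.exp (k * s)) (Ici 0) := by
    refine antitoneOn_of_hasDerivWithinAt_nonpos (convex_Ici 0)
      (fun s hs => (hder s hs).continuousAt.continuousWithinAt)
      (fun s hs => (hder s (interior_subset hs)).hasDerivWithinAt) fun s hs => ?_
    have := hkW (w s) (hbox s (interior_subset hs))
    nlinarith [mul_nonneg (sub_nonneg.2 this) (Real.exp_pos (k * s)).le]
  have hexp : Tendsto (fun s : ℝ => Real.exp (-(k * s))) atTop (𝓝 0) :=
    Real.tendsto_exp_neg_atTop_nhds_zero.comp (tendsto_id.const_mul_atTop hk)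
  set C := (lyapunov (w 0) + 4 / 27) / (Real.exp (-12) / 2)
  have hsq : ∀ s, 0 ≤ s → (w s).1 ^ 2 + (w s).2 ^ 2 ≤ C * Real.exp (-(k * s)) := by
    intro s hs
    have h1 := sq_add_sq_le_lyapunov (hbox s hs)
    have h2 := hanti self_mem_Ici hs hs
    simp only [mul_zero, Real.exp_zero, mul_one] at h2
    rw [← le_div_iff₀ (Real.exp_pos _), div_eq_mul_inv _ (Real.exp _), ← Real.exp_neg] at h2
    rw [div_mul_eq_mul_div, le_div_iff₀ (by positivity)]
    linarith
  have hlim : Tendsto (fun s => C * Real.exp (-(k * s))) atTop (𝓝 0) := by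
    simpa using hexp.const_mul C
  have sqrt_lim : Tendsto (fun s => √(C * Real.exp (-(k * s)))) atTop (𝓝 0) := by
    simpa using hlim.sqrt
  refine squeeze_zero_norm' ?_ sqrt_lim
  filter_upwards [eventually_ge_atTop 0] with s hs
  have := hsq s hs
  refine max_le ?_ ?_ <;> refine Real.abs_le_sqrt ?_ <;>
    linarith [sq_nonneg (w s).1, sq_nonneg (w s).2]

/-! ### Existence of the homoclinic arc -/

/-- The projection of the plane onto `box`. -/
noncomputable def clamp (w : ℝ × ℝ) : ℝ × ℝ :=
  (projIcc (-1 / 5 : ℝ) 2 (by norm_num) w.1, projIcc (-2 : ℝ) 1 (by norm_num) w.2)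

theorem clamp_mem (w : ℝ × ℝ) : clamp w ∈ box := ⟨Subtype.prop _, Subtype.prop _⟩

theorem clamp_of_mem {w : ℝ × ℝ} (hw : w ∈ box) : clamp w = w := by
  refine Prod.ext ?_ ?_
  · simp only [clamp, projIcc_of_mem _ hw.1]
  · simp only [clamp, projIcc_of_mem _ hw.2]

theorem lipschitzWith_clamp : LipschitzWith 1 clamp := by
  have h1 := (LipschitzWith.subtype_val (Icc (-1 / 5 : ℝ) 2)).comp
    ((LipschitzWith.projIcc (by norm_num)).comp (LipschitzWith.prod_fst (α := ℝ) (β := ℝ)))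
  have h2 := (LipschitzWith.subtype_val (Icc (-2 : ℝ) 1)).comp
    ((LipschitzWith.projIcc (by norm_num)).comp (LipschitzWith.prod_snd (α := ℝ) (β := ℝ)))
  simpa using! h1.prodMk h2

theorem isCompact_box : IsCompact box := isCompact_Icc.prod isCompact_Icc

theorem contDiffOn_field : ContDiffOn ℝ 1 field box := by
  have hne : ∀ w ∈ box, 2 - w.2 ≠ 0 := fun w hw =>
    (sub_pos.2 (hw.2.2.trans_lt (by norm_num))).ne'
  refine ContDiffOn.prodMk (ContDiffOn.div ?_ ?_ hne) (ContDiffOn.div ?_ ?_ hne) <;> fun_prop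

/-- The solution of `field` that starts at `(3/2, 1)` exists for all positive times, satisfies
`v < 1`, and tends to the origin. -/
theorem exists_homoclinic_arc : ∃ w : ℝ → ℝ × ℝ, w 0 = (3 / 2, 1) ∧
    (∀ s, 0 ≤ s → HasDerivAt w (field (w s)) s) ∧ (∀ s, 0 < s → (w s).2 < 1) ∧
    Tendsto w atTop (𝓝 0) := by
  obtain ⟨K, hK⟩ := contDiffOn_field.exists_lipschitzOnWith (by norm_num)
    ((convex_Icc _ _).prod (convex_Icc _ _)) isCompact_box
  obtain ⟨L, hL⟩ := isCompact_box.exists_bound_of_continuousOn contDiffOn_field.continuousOn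
  -- Composing with `clamp` makes the field globally Lipschitz and bounded without changing it on
  -- the box.
  have hlip : LipschitzWith (K * 1) (field ∘ clamp) := by
    rw [← lipschitzOnWith_univ]
    exact hK.comp lipschitzWith_clamp.lipschitzOnWith fun w _ => clamp_mem w
  obtain ⟨w, hw0, hw⟩ := exists_isIntegralCurve_of_lipschitzWith_of_bounded hlip
    (L := L.toNNReal) (fun x => (hL _ (clamp_mem x)).trans (Real.le_coe_toNNReal L)) (3 / 2, 1)
  have hw' : ∀ s, w s ∈ box → HasDerivAt w (field (w s)) s := fun s hs => by
    have := hw s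
    simpa only [Function.comp_apply, clamp_of_mem hs] using this
  have hin : ∀ s, 0 < s → w s ∈ openBox := fun s hs => mem_openBox hw.continuous hw0 hw' hs
  have hbox : ∀ s, 0 ≤ s → w s ∈ box := fun s hs => by
    rcases hs.eq_or_lt with rfl | hs
    · rw [hw0]; refine ⟨⟨?_, ?_⟩, ?_, ?_⟩ <;> norm_num
    · exact openBox_subset_box (hin s hs)
  exact ⟨w, hw0, fun s hs => hw' s (hbox s hs), fun s hs => (hin s hs).2.2,
    tendsto_zero hbox fun s hs => hw' s (hbox s hs)⟩

end PlanarSliding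

/-! ### The sliding vector field in coordinates -/

namespace piecewiseLinear

variable {α β : ℝ}

theorem hasFDerivAt_apply (i : Fin 3) (ξ : E3) :
    HasFDerivAt (fun v : E3 => v i) (EuclideanSpace.proj (𝕜 := ℝ) i) ξ :=
  (EuclideanSpace.proj (𝕜 := ℝ) i).hasFDerivAt

theorem Xh_apply (ξ : E3) : (piecewiseLinear α β).Xh ξ = ξ 1 - 3 * β ^ 2 / (8 * α) := by
  simp only [PiecewiseVectorField.Xh, dirDeriv, piecewiseLinear, (hasFDerivAt_apply 2 ξ).fderiv]
  simp

theorem Yh_apply (ξ : E3) : (piecewiseLinear α β).Yh ξ = 3 * β ^ 2 / (8 * α) := by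
  simp only [PiecewiseVectorField.Yh, dirDeriv, piecewiseLinear, (hasFDerivAt_apply 2 ξ).fderiv]
  simp

theorem X_Xh_apply (ξ : E3) :
    dirDeriv (piecewiseLinear α β).X (piecewiseLinear α β).Xh ξ = ξ 0 - β := by
  have : (piecewiseLinear α β).Xh = fun ξ => ξ 1 - 3 * β ^ 2 / (8 * α) := funext Xh_apply
  rw [dirDeriv, this, ((hasFDerivAt_apply 1 ξ).sub_const _).fderiv]
  simp [piecewiseLinear]

theorem mem_slidingRegion_iff (hα : 0 < α) (hβ : 0 < β) {ξ : E3} :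
    ξ ∈ (piecewiseLinear α β).slidingRegion ↔ ξ 2 = 0 ∧ ξ 1 < 3 * β ^ 2 / (8 * α) := by
  have hc : 0 < 3 * β ^ 2 / (8 * α) := by positivity
  simp only [PiecewiseVectorField.slidingRegion, mem_ofPred_eq, Xh_apply, Yh_apply, sub_neg, hc,
    and_true]
  rfl

theorem slidingField_eq (hα : 0 < α) (hβ : 0 < β) (ξ : E3) :
    (piecewiseLinear α β).slidingField ξ =
      !₂[-α * ξ 1 / (3 * β ^ 2 / (4 * α) - ξ 1),
        (3 * β ^ 2 / (8 * α) * ξ 0 + β / 8 * ξ 1 - 3 * α / β * ξ 1 ^ 2) /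
          (3 * β ^ 2 / (4 * α) - ξ 1), 0] := by
  have hd : 3 * β ^ 2 / (8 * α) - (ξ 1 - 3 * β ^ 2 / (8 * α)) =
      3 * β ^ 2 / (4 * α) - ξ 1 := by
    field_simp
    ring
  rw [PiecewiseVectorField.slidingField, Xh_apply, Yh_apply, hd]
  ext i
  fin_cases i
  · simp only [piecewiseLinear, div_eq_inv_mul]
    simp
    field_simp
    ring
  · simp [piecewiseLinear, div_eq_inv_mul]
    left
    field_simp
    ring
  · simp [piecewiseLinear]
    right
    ring

theorem contDiffAt_slidingField (hα : 0 < α) (hβ : 0 < β) {ξ : E3}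
    (hξ : ξ 1 ≠ 3 * β ^ 2 / (4 * α)) :
    ContDiffAt ℝ 1 (piecewiseLinear α β).slidingField ξ := by
  have hne : 3 * β ^ 2 / (4 * α) - ξ 1 ≠ 0 := sub_ne_zero.2 hξ.symm
  rw [funext (slidingField_eq hα hβ), contDiffAt_euclidean]
  intro i
  fin_cases i
  · exact ContDiffAt.div (by fun_prop) (by fun_prop) hne
  · exact ContDiffAt.div (by fun_prop) (by fun_prop) hne
  · exact contDiffAt_const

/-! ### Linearization at the pseudo-equilibrium -/

theorem fderiv_slidingField_zero (hα : 0 < α) (hβ : 0 < β) (v : E3) :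
    fderiv ℝ (piecewiseLinear α β).slidingField 0 v =
      !₂[-(4 * α ^ 2 / (3 * β ^ 2)) * v 1, v 0 / 2 + α / (6 * β) * v 1, 0] := by
  have hc : (3 * β ^ 2 / (4 * α)) ≠ 0 := by positivity
  have hdiff := (contDiffAt_slidingField hα hβ (ξ := 0) (by simpa using hc.symm)).differentiableAt
    (by norm_num)
  -- Differentiability being known, the derivative is read off along the line t • v by the
  -- one-variable quotient rule.
  have hline : HasDerivAt (fun t : ℝ => t • v) v 0 := by
    simpa using (hasDerivAt_id (0 : ℝ)).smul_const v
  have h1 : HasDerivAt (fun t : ℝ => (piecewiseLinear α β).slidingField (t • v))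
      (fderiv ℝ (piecewiseLinear α β).slidingField 0 v) 0 := by
    have : HasFDerivAt (piecewiseLinear α β).slidingField
        (fderiv ℝ (piecewiseLinear α β).slidingField 0) ((0 : ℝ) • v) := by
      simpa using hdiff.hasFDerivAt
    exact this.comp_hasDerivAt 0 hline
  have hcoord : ∀ i : Fin 3, HasDerivAt
      (fun t : ℝ => (piecewiseLinear α β).slidingField (t • v) i)
      (fderiv ℝ (piecewiseLinear α β).slidingField 0 v i) 0 := fun i =>
    (EuclideanSpace.proj (𝕜 := ℝ) i).hasFDerivAt.comp_hasDerivAt 0 h1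
  have hlin : ∀ a : ℝ, HasDerivAt (fun t : ℝ => t * a) a 0 := fun a => by
    simpa using (hasDerivAt_id (0 : ℝ)).mul_const a
  have hden : HasDerivAt (fun t : ℝ => 3 * β ^ 2 / (4 * α) - t * v 1) (-v 1) 0 := by
    simpa using (hlin (v 1)).const_sub (3 * β ^ 2 / (4 * α))
  have hden0 : 3 * β ^ 2 / (4 * α) - 0 * v 1 ≠ 0 := by simpa using hc
  simp only [slidingField_eq hα hβ] at hcoord
  ext i
  refine (hcoord i).unique ?_
  fin_cases i
  · refine (((hlin (v 1)).const_mul (-α)).div hden hden0).congr_deriv ?_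
    simp
    field_simp
  · refine (((((hlin (v 0)).const_mul (3 * β ^ 2 / (8 * α))).add
      ((hlin (v 1)).const_mul (β / 8))).sub
      (((hlin (v 1)).pow 2).const_mul (3 * α / β))).div hden hden0).congr_deriv ?_
    simp
    field_simp
    ring
  · exact hasDerivAt_const _ _

theorem mem_tangentPlane_iff {ξ v : E3} :
    v ∈ (piecewiseLinear α β).tangentPlane ξ ↔ v 2 = 0 := by
  have : fderiv ℝ (piecewiseLinear α β).h ξ = EuclideanSpace.proj (𝕜 := ℝ) (2 : Fin 3) :=
    (hasFDerivAt_apply 2 ξ).fderiv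
  rw [PiecewiseVectorField.tangentPlane, this]
  rfl

/-- The coordinates `(x, y)` on the tangent plane. -/
noncomputable def tangentPlaneEquiv (α β : ℝ) (ξ : E3) :
    (piecewiseLinear α β).tangentPlane ξ ≃ₗ[ℝ] (Fin 2 → ℝ) where
  toFun v := ![v.1 0, v.1 1]
  invFun a := ⟨!₂[a 0, a 1, 0], mem_tangentPlane_iff.2 (by simp)⟩
  map_add' v w := by simp
  map_smul' r v := by simp
  left_inv v := by
    ext i
    have := mem_tangentPlane_iff.1 v.2
    fin_cases i
    · simp
    · simp
    · simpa using this.symm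
  right_inv a := by
    ext i
    fin_cases i <;> simp

theorem slidingLinearization_zero_apply (hα : 0 < α) (hβ : 0 < β)
    (v : (piecewiseLinear α β).tangentPlane 0) :
    ((piecewiseLinear α β).slidingLinearization 0 v : E3) =
      !₂[-(4 * α ^ 2 / (3 * β ^ 2)) * v.1 1, v.1 0 / 2 + α / (6 * β) * v.1 1, 0] := by
  have hmem : fderiv ℝ (piecewiseLinear α β).slidingField 0 (v : E3) ∈
      (piecewiseLinear α β).tangentPlane 0 := by
    rw [mem_tangentPlane_iff, fderiv_slidingField_zero hα hβ]
    simp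
  have := Submodule.orthogonalProjectionOnto_mem_subspace_eq_self
    (K := (piecewiseLinear α β).tangentPlane 0) ⟨_, hmem⟩
  refine (congrArg Subtype.val this).trans ?_
  exact fderiv_slidingField_zero hα hβ _

theorem charpoly_slidingLinearization_zero (hα : 0 < α) (hβ : 0 < β) :
    ((piecewiseLinear α β).slidingLinearization 0).charpoly =
      Polynomial.X ^ 2 - Polynomial.C (α / (6 * β)) * Polynomial.X +
        Polynomial.C (2 * α ^ 2 / (3 * β ^ 2)) := by
  set b := Module.Basis.ofEquivFun (tangentPlaneEquiv α β 0)
  have hM : LinearMap.toMatrix b b ((piecewiseLinear α β).slidingLinearization 0) =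
      !![0, -(4 * α ^ 2 / (3 * β ^ 2)); 1 / 2, α / (6 * β)] := by
    have hb : ∀ j, ((b j : (piecewiseLinear α β).tangentPlane 0) : E3) =
        !₂[(Pi.single j 1 : Fin 2 → ℝ) 0, (Pi.single j 1 : Fin 2 → ℝ) 1, 0] := fun j => by
      simp [b, tangentPlaneEquiv]
    ext i j
    rw [LinearMap.toMatrix_apply]
    have hr : ∀ v, b.repr v i = ![v.1 0, v.1 1] i := fun v => rfl
    rw [hr, slidingLinearization_zero_apply hα hβ, hb]
    fin_cases i <;> fin_cases j <;> simp
  rw [← LinearMap.charpoly_toMatrix _ b, hM, Matrix.charpoly_fin_two, Matrix.trace_fin_two,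
    Matrix.det_fin_two]
  simp only [Matrix.of_apply, Matrix.cons_val', Matrix.cons_val_zero, Matrix.cons_val_one,
    Matrix.cons_val_fin_one, zero_add, zero_mul, zero_sub]
  congr 2
  field_simp
  ring

theorem slidingEigenvalues_zero (hα : 0 < α) (hβ : 0 < β) :
    (piecewiseLinear α β).slidingEigenvalues 0 =
      {((α : ℂ) + Complex.I * (Real.sqrt 95 : ℝ) * (α : ℂ)) / (12 * (β : ℂ)),
        ((α : ℂ) - Complex.I * (Real.sqrt 95 : ℝ) * (α : ℂ)) / (12 * (β : ℂ))} := by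
  set l₁ : ℂ := ((α : ℂ) + Complex.I * (Real.sqrt 95 : ℝ) * (α : ℂ)) / (12 * (β : ℂ)) with h₁
  set l₂ : ℂ := ((α : ℂ) - Complex.I * (Real.sqrt 95 : ℝ) * (α : ℂ)) / (12 * (β : ℂ)) with h₂
  have hβ' : (β : ℂ) ≠ 0 := by exact_mod_cast hβ.ne'
  have hsum : (α : ℂ) / (6 * β) = l₁ + l₂ := by
    rw [h₁, h₂]
    field_simp
    ring
  have h95 : ((Real.sqrt 95 : ℝ) : ℂ) ^ 2 = 95 := by
    rw [← Complex.ofReal_pow, Real.sq_sqrt (by norm_num)]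
    norm_num
  have hprod : 2 * (α : ℂ) ^ 2 / (3 * β ^ 2) = l₁ * l₂ := by
    rw [h₁, h₂]
    field_simp
    ring_nf
    rw [h95, Complex.I_sq]
    ring
  have hfac : (((piecewiseLinear α β).slidingLinearization 0).charpoly).map (algebraMap ℝ ℂ) =
      (Polynomial.X - Polynomial.C l₁) * (Polynomial.X - Polynomial.C l₂) := by
    rw [charpoly_slidingLinearization_zero hα hβ]
    simp only [Polynomial.map_add, Polynomial.map_sub, Polynomial.map_mul, Polynomial.map_pow,
      Polynomial.map_X, Polynomial.map_C, Complex.coe_algebraMap]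
    push_cast
    rw [hsum, hprod, Polynomial.C_add, Polynomial.C_mul]
    ring
  rw [PiecewiseVectorField.slidingEigenvalues, Polynomial.aroots, hfac, Polynomial.roots_mul
    (mul_ne_zero (Polynomial.X_sub_C_ne_zero _) (Polynomial.X_sub_C_ne_zero _)),
    Polynomial.roots_X_sub_C, Polynomial.roots_X_sub_C]
  rfl

theorem zero_mem_slidingRegion (hα : 0 < α) (hβ : 0 < β) :
    (0 : E3) ∈ (piecewiseLinear α β).slidingRegion := by
  rw [mem_slidingRegion_iff hα hβ]
  exact ⟨rfl, by simp; positivity⟩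

theorem isUnstableHyperbolicFocus_zero (hα : 0 < α) (hβ : 0 < β) :
    (piecewiseLinear α β).IsUnstableHyperbolicFocus 0 := by
  have hc : (3 * β ^ 2 / (4 * α)) ≠ 0 := by positivity
  refine ⟨⟨Or.inl (zero_mem_slidingRegion hα hβ),
    contDiffAt_slidingField hα hβ (by simpa using hc.symm), ?_⟩, ?_⟩
  · rw [slidingField_eq hα hβ]
    ext i
    fin_cases i <;> simp
  · have key : ∀ s : ℝ, s ≠ 0 → 0 < (((α : ℂ) + Complex.I * s * α) / (12 * β)).re ∧
        (((α : ℂ) + Complex.I * s * α) / (12 * β)).im ≠ 0 := by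
      intro s hs
      have : ((α : ℂ) + Complex.I * s * α) / (12 * β) =
          ((α / (12 * β) : ℝ) : ℂ) + ((s * α / (12 * β) : ℝ) : ℂ) * Complex.I := by
        push_cast
        ring
      rw [this]
      simp only [Complex.add_re, Complex.ofReal_re, Complex.re_ofReal_mul, Complex.I_re, mul_zero,
        add_zero, Complex.add_im, Complex.ofReal_im, Complex.im_ofReal_mul, Complex.I_im, mul_one,
        zero_add]
      exact ⟨by positivity, by positivity⟩
    have h95 : √(95 : ℝ) ≠ 0 := by positivity
    intro l hl
    rw [slidingEigenvalues_zero hα hβ, Multiset.insert_eq_cons, Multiset.mem_cons,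
      Multiset.mem_singleton] at hl
    rcases hl with rfl | rfl
    · exact key _ h95
    · have := key (-√95) (neg_ne_zero.2 h95)
      rwa [Complex.ofReal_neg, mul_neg, neg_mul, ← sub_eq_add_neg] at this

/-! ### The fold point and its two arcs -/

theorem fold_mem_relBoundary (hα : 0 < α) (hβ : 0 < β) :
    !₂[3 * β / 2, 3 * β ^ 2 / (8 * α), 0] ∈
      (piecewiseLinear α β).relBoundary (piecewiseLinear α β).slidingRegion := by
  refine ⟨⟨by simp [PiecewiseVectorField.switchingSurface, piecewiseLinear], ?_⟩,
    subset_closure ⟨by simp [PiecewiseVectorField.switchingSurface, piecewiseLinear], ?_⟩⟩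
  -- Lowering y by t > 0 moves the fold point into Σˢ.
  · set f : ℝ → E3 := fun t => !₂[3 * β / 2, 3 * β ^ 2 / (8 * α) - t, 0] with hf
    have hcont : Continuous f := by
      rw [continuous_iff_continuousAt]
      intro t
      refine ContDiffAt.continuousAt (n := 1) (𝕜 := ℝ) (contDiffAt_euclidean.2 fun i => ?_)
      fin_cases i <;> simp [hf] <;> fun_prop
    have hlim : Tendsto f (𝓝[>] 0) (𝓝 (f 0)) := hcont.continuousAt.continuousWithinAt
    rw [hf] at hlim
    simp only [sub_zero] at hlim
    refine mem_closure_of_tendsto hlim ?_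
    filter_upwards [self_mem_nhdsWithin] with t ht
    rw [mem_slidingRegion_iff hα hβ]
    simpa using ht
  · rw [mem_slidingRegion_iff hα hβ]
    simp

theorem isVisibleFoldRegular_fold (hα : 0 < α) (hβ : 0 < β) :
    (piecewiseLinear α β).IsVisibleFoldRegular !₂[3 * β / 2, 3 * β ^ 2 / (8 * α), 0] := by
  refine ⟨Or.inl (fold_mem_relBoundary hα hβ), ⟨by simp [piecewiseLinear], by simp [Xh_apply], ?_,
    ?_⟩, ?_⟩
  · rw [show (piecewiseLinear α β).Xh = fun ξ => ξ 1 - 3 * β ^ 2 / (8 * α) from funext Xh_apply]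
    fun_prop
  · rw [X_Xh_apply]
    simp
    linarith
  · rw [Yh_apply]
    positivity

/-- The orbit of `X` that starts at the fold point. -/
noncomputable def foldOrbit (α β t : ℝ) : E3 :=
  !₂[3 * β / 2 - α * t, 3 * β ^ 2 / (8 * α) + β / 2 * t - α / 2 * t ^ 2,
    β / 4 * t ^ 2 - α / 6 * t ^ 3]

theorem hasDerivAt_of_coord {γ : ℝ → E3} {v : E3} {t : ℝ}
    (h : ∀ i, HasDerivAt (fun s => γ s i) (v i) t) : HasDerivAt γ v t := by
  rw [hasDerivAt_iff_hasFDerivAt, ← hasFDerivWithinAt_univ, hasFDerivWithinAt_euclidean]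
  intro i
  refine (h i).hasFDerivAt.hasFDerivWithinAt.congr_fderiv ?_
  ext
  simp

theorem isIntegralCurve_foldOrbit :
    IsIntegralCurve (foldOrbit α β) fun _ => (piecewiseLinear α β).X := by
  intro t
  refine hasDerivAt_of_coord fun i => ?_
  fin_cases i
  · refine (((hasDerivAt_id t).const_mul α).const_sub (3 * β / 2)).congr_deriv ?_
    simp [piecewiseLinear]
  · refine ((((hasDerivAt_id t).const_mul (β / 2)).const_add (3 * β ^ 2 / (8 * α))).sub
      (((hasDerivAt_id t).pow 2).const_mul (α / 2))).congr_deriv ?_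
    simp [piecewiseLinear, foldOrbit]
    ring
  · refine ((((hasDerivAt_id t).pow 2).const_mul (β / 4)).sub
      (((hasDerivAt_id t).pow 3).const_mul (α / 6))).congr_deriv ?_
    simp [piecewiseLinear, foldOrbit]
    ring

/-- The backward sliding orbit of the fold point, obtained from an orbit of the dimensionless
system. -/
noncomputable def slidingOrbit (α β : ℝ) (w : ℝ → ℝ × ℝ) (t : ℝ) : E3 :=
  !₂[β * (w (-(8 * α / (3 * β)) * t)).1, 3 * β ^ 2 / (8 * α) * (w (-(8 * α / (3 * β)) * t)).2, 0]

theorem hasDerivAt_slidingOrbit (hα : 0 < α) (hβ : 0 < β) {w : ℝ → ℝ × ℝ} {t : ℝ}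
    (h2 : (w (-(8 * α / (3 * β)) * t)).2 ≠ 2)
    (hw : HasDerivAt w (PlanarSliding.field (w (-(8 * α / (3 * β)) * t)))
      (-(8 * α / (3 * β)) * t)) :
    HasDerivAt (slidingOrbit α β w)
      ((piecewiseLinear α β).slidingField (slidingOrbit α β w t)) t := by
  have hlin : HasDerivAt (fun s : ℝ => -(8 * α / (3 * β)) * s) (-(8 * α / (3 * β))) t := by
    simpa using (hasDerivAt_id t).const_mul (-(8 * α / (3 * β)))
  have hcomp := hw.scomp t hlin
  have hu : HasDerivAt (fun s => (w (-(8 * α / (3 * β)) * s)).1)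
      (-(8 * α / (3 * β)) * (PlanarSliding.field (w (-(8 * α / (3 * β)) * t))).1) t := hcomp.fst
  have hv : HasDerivAt (fun s => (w (-(8 * α / (3 * β)) * s)).2)
      (-(8 * α / (3 * β)) * (PlanarSliding.field (w (-(8 * α / (3 * β)) * t))).2) t := hcomp.snd
  have hd : 2 - (w (-(8 * α / (3 * β)) * t)).2 ≠ 0 := sub_ne_zero.2 h2.symm
  have hd' : 3 * β ^ 2 / (4 * α) -
      3 * β ^ 2 / (8 * α) * (w (-(8 * α / (3 * β)) * t)).2 =
        3 * β ^ 2 / (8 * α) * (2 - (w (-(8 * α / (3 * β)) * t)).2) := by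
    field_simp
    ring
  rw [slidingField_eq hα hβ]
  refine hasDerivAt_of_coord fun i => ?_
  fin_cases i
  · refine (hu.const_mul β).congr_deriv ?_
    simp [slidingOrbit, PlanarSliding.field, -neg_mul]
    rw [hd']
    field_simp
  · refine (hv.const_mul (3 * β ^ 2 / (8 * α))).congr_deriv ?_
    simp [slidingOrbit, PlanarSliding.field, -neg_mul]
    rw [hd']
    field_simp
    ring
  · exact hasDerivAt_const _ _

theorem tendsto_slidingOrbit (hα : 0 < α) (hβ : 0 < β) {w : ℝ → ℝ × ℝ}
    (hw : Tendsto w atTop (𝓝 0)) : Tendsto (slidingOrbit α β w) atBot (𝓝 0) := by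
  have hk : -(8 * α / (3 * β)) < 0 := neg_neg_of_pos (by positivity)
  have h1 : Tendsto (fun t => w (-(8 * α / (3 * β)) * t)) atBot (𝓝 0) :=
    hw.comp (tendsto_id.const_mul_atBot_of_neg hk)
  have hcont : Continuous fun p : ℝ × ℝ => (!₂[β * p.1, 3 * β ^ 2 / (8 * α) * p.2, 0] : E3) := by
    refine ContDiff.continuous (n := 1) (𝕜 := ℝ) (contDiff_euclidean.2 fun i => ?_)
    fin_cases i <;> simp <;> fun_prop
  have h0 : (!₂[β * (0 : ℝ × ℝ).1, 3 * β ^ 2 / (8 * α) * (0 : ℝ × ℝ).2, 0] : E3) = 0 := by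
    ext i
    fin_cases i <;> simp
  have := (hcont.tendsto 0).comp h1
  rwa [h0] at this

theorem exists_isSlidingShilnikovOrbit (hα : 0 < α) (hβ : 0 < β) :
    ∃ Γ : Set E3, (piecewiseLinear α β).IsSlidingShilnikovOrbit 0
      !₂[3 * β / 2, 3 * β ^ 2 / (8 * α), 0] (3 * β / (2 * α)) Γ := by
  obtain ⟨w, hw0, hw, hw1, hlim⟩ := PlanarSliding.exists_homoclinic_arc
  have hk : 0 < 8 * α / (3 * β) := by positivity
  have hp := zero_mem_slidingRegion hα hβ
  have hle : ∀ s, 0 ≤ s → (w s).2 < 2 := fun s hs => by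
    rcases hs.eq_or_lt with rfl | hs
    · rw [hw0]; norm_num
    · linarith [hw1 s hs]
  refine ⟨_, Or.inl ⟨hp, isUnstableHyperbolicFocus_zero hα hβ⟩, isVisibleFoldRegular_fold hα hβ,
    Or.inl ⟨hp, fold_mem_relBoundary hα hβ, by positivity, slidingOrbit α β w, foldOrbit α β,
      ⟨?_, ?_, ?_, tendsto_slidingOrbit hα hβ hlim⟩,
      ⟨?_, isIntegralCurve_foldOrbit.isIntegralCurveOn _, ?_, ?_⟩, rfl⟩⟩
  · simp only [slidingOrbit, mul_zero, hw0]
    ext i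
    fin_cases i <;> simp
    ring
  · intro t ht
    have hs : 0 ≤ -(8 * α / (3 * β)) * t := by nlinarith [mem_Iic.1 ht]
    exact (hasDerivAt_slidingOrbit hα hβ (hle _ hs).ne (hw _ hs)).hasDerivWithinAt
  · intro t ht
    have hs : 0 < -(8 * α / (3 * β)) * t := by nlinarith
    rw [mem_slidingRegion_iff hα hβ]
    refine ⟨by simp [slidingOrbit], ?_⟩
    have hc : 0 < 3 * β ^ 2 / (8 * α) := by positivity
    have := mul_lt_mul_of_pos_left (hw1 _ hs) hc
    simpa [slidingOrbit] using this
  · ext i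
    fin_cases i <;> simp [foldOrbit]
  · rintro t ⟨h0, h1⟩
    rw [lt_div_iff₀ (by positivity)] at h1
    -- The double zero is the tangency at the fold; the remaining factor vanishes exactly at the
    -- arrival time.
    have : (piecewiseLinear α β).h (foldOrbit α β t) = t ^ 2 * (3 * β - t * (2 * α)) / 12 := by
      simp [piecewiseLinear, foldOrbit]
      ring
    rw [this]
    have := sub_pos.2 h1
    positivity
  · ext i
    fin_cases i <;> simp [foldOrbit] <;> field_simp <;> ring

end piecewiseLinear

theorem proposition1 (α β : ℝ) (hα : 0 < α) (hβ : 0 < β) :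
    ((piecewiseLinear α β).IsHyperbolicPseudoSaddleFocus 0 ∧
      (0 : E3) ∈ (piecewiseLinear α β).slidingRegion ∧
      (piecewiseLinear α β).IsUnstableHyperbolicFocus 0 ∧
      (piecewiseLinear α β).slidingEigenvalues 0 =
        {((α : ℂ) + Complex.I * (Real.sqrt 95 : ℝ) * (α : ℂ)) / (12 * (β : ℂ)),
          ((α : ℂ) - Complex.I * (Real.sqrt 95 : ℝ) * (α : ℂ)) / (12 * (β : ℂ))}) ∧
    ((piecewiseLinear α β).IsVisibleFoldRegular !₂[3 * β / 2, 3 * β ^ 2 / (8 * α), 0] ∧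
      ∃ Γ : Set E3, (piecewiseLinear α β).IsSlidingShilnikovOrbit 0
        !₂[3 * β / 2, 3 * β ^ 2 / (8 * α), 0] (3 * β / (2 * α)) Γ) :=
  have hp := piecewiseLinear.zero_mem_slidingRegion hα hβ
  have hf := piecewiseLinear.isUnstableHyperbolicFocus_zero hα hβ
  ⟨⟨Or.inl ⟨hp, hf⟩, hp, hf, piecewiseLinear.slidingEigenvalues_zero hα hβ⟩,
    piecewiseLinear.isVisibleFoldRegular_fold hα hβ,
    piecewiseLinear.exists_isSlidingShilnikovOrbit hα hβ⟩
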